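/- **Instruction sequences.** Consider Boolean registers: input registers $\mathrm{in}{:}1,\mathrm{in}{:}2,\ldots$, auxiliary registers $\mathrm{aux}{:}1,\mathrm{aux}{:}2,\ldots$, and one output register $\mathrm{out}$. The basic instructions are $f.\mathrm{get}$ (reply: the content of $f$) for $f$ an input or auxiliary register, and $f.\mathrm{set}{:}b$ (the content of $f$ becomes $b$; reply: $b$) for $f$ an auxiliary register or $\mathrm{out}$ and $b\in\mathbb B=\{\mathsf T,\mathsf F\}$. Let $IS_{br}$ be the set of all non-empty finite sequences of primitive instructions, which are: a plain basic instruction $a$, a positive test $+a$, a negative test $-a$, a forward jump $\#l$ ($l\in\mathbb N$), and termination $!$. Execution starts at the first instruction. After $a$ it proceeds with the next instruction; after $+a$ (resp. $-a$) it proceeds with the next instruction if the reply is $\mathsf T$ (resp. $\mathsf F$) and skips one instruction otherwise; $\#l$ proceeds with the $l$th next instruction; $!$ terminates. If there is no instruction to proceed with, or at $\#0$, execution becomes inactive. $X\in IS_{br}$ *computes* $f:\mathbb B^n\to\mathbb B$ if for some $l$, for all $b_1,\ldots,b_n\in\mathbb B$, execution of $X$ with only the registers $\mathrm{in}{:}1,\ldots,\mathrm{in}{:}n$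 (initial contents $b_1,\ldots,b_n$), $\mathrm{aux}{:}1,\ldots,\mathrm{aux}{:}l$ and $\mathrm{out}$ (initial contents $\mathsf F$) available terminates (without accessing any other register) with content $f(b_1,\ldots,b_n)$ in $\mathrm{out}$. **Classes and completeness.** A Boolean function family is a sequence $(f_n)_{n\in\mathbb N}$ with $f_n:\mathbb B^n\to\mathbb B$. Let $\mathrm{poly}$ be the set of all $h:\mathbb N\to\mathbb N$ with $h(n)=O(n^k)$ for some $k\in\mathbb N$. - $\mathrm{PLIS}$ is the class of all families $(f_n)$ for which there is an $h\in\mathrm{poly}$ such that each $f_n$ is computed by some $X\in IS_{br}$ of length at most $h(n)$. - $\mathrm{NPLIS}$ is the class of all families $(f_n)$ for which there are a monotonic (non-decreasing) $h\in\mathrm{poly}$ and a family $(g_n)\in\mathrm{PLIS}$ such that, for all $n$ and all $w\in\mathbb B^n$, $f_n(w)=\mathsf T$ iff $g_{n+h(n)}(w\,c)=\mathsf T$ for some $c\in\mathbb B^{h(n)}$. - $(f_n)$ is *non-uniform polynomial-length $IS_{br}$-reducible* to $(g_n)$ if there is an $h\in\mathrm{poly}$ such that for all $n$ there are $l,m\le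 h(n)$ and functions $h_1,\ldots,h_m:\mathbb B^n\to\mathbb B$, each computed by an element of $IS_{br}$ of length at most $l$, with $f_n(b)=g_m(h_1(b),\ldots,h_m(b))$ for all $b\in\mathbb B^n$. - A family is *$\mathrm{NPLIS}$-complete* if it lies in $\mathrm{NPLIS}$ and every family in $\mathrm{NPLIS}$ is non-uniform polynomial-length $IS_{br}$-reducible to it. **3SATC.** For $k\in\mathbb N$ let $d(k)=\binom{2k}{1}+\binom{2k}{2}+\binom{2k}{3}$, and let $$\alpha_k:\{1,\ldots,d(k)\}\to\{L\subseteq\{v_1,\lnot v_1,\ldots,v_k,\lnot v_k\} : 1\le |L|\le 3\}\qquad(k\in\mathbb N)$$ be any family of bijections such that $\alpha_{k+1}(j)=\alpha_k(j)$ for all $k$ and all $j\le d(k)$ (in particular, any such family that is computable in polynomial time). The family $\mathrm{3SATC}=(\mathrm{3SATC}_n)_{n\in\mathbb N}$ is defined as follows: for $n\in\mathbb N$, let $k$ be the unique number with $d(k)\le n<d(k+1)$; then $\mathrm{3SATC}_n(b_1,\ldots,b_n)=\mathsf T$ iff the formula $$\bigwedge_{1\le i\le d(k),\ b_i=\mathsf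 T}\ \bigvee\alpha_k(i)$$ is satisfiable. **Theorem.** $\mathrm{3SATC}$ is $\mathrm{NPLIS}$-complete. -/

import Mathlib

namespace InSeq

/-! ### Instructions and finite instruction sequences -/

/-- Names of Boolean registers. Registers are counted from `0`: `inp i` and `aux i` name the
`(i+1)`-th input register and the `(i+1)`-th auxiliary register. -/
inductive Focus where
  | inp (i : ℕ)
  | aux (i : ℕ)
  | out
  deriving DecidableEq

/-- The methods of Boolean registers: `set b` and `get`. -/
inductive Method where
  | set (b : Bool)
  | get

/-- A basic instruction `f.m`; basic instructions also serve as the basic actions of threads. -/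
structure Basic where
  focus : Focus
  method : Method

/-- Primitive instructions: plain basic instructions `a`, positive tests `+a`, negative tests
`-a`, forward jumps `#l` and the termination instruction `!`. -/
inductive Instr where
  | plain (a : Basic)
  | ptst (a : Basic)
  | ntst (a : Basic)
  | jump (l : ℕ)
  | halt

/-- The basic instructions that read an input register, read or write an auxiliary register, or
write the output register. -/
def Basic.Allowed : Basic → Prop
  | ⟨.inp _, .get⟩ => True
  | ⟨.inp _, .set _⟩ => False
  | ⟨.aux _, _⟩ => True
  | ⟨.out, .set _⟩ => True
  | ⟨.out, .get⟩ => False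

/-- The primitive instructions all of whose basic instructions are allowed. -/
def Instr.Allowed : Instr → Prop
  | .plain a => a.Allowed
  | .ptst a => a.Allowed
  | .ntst a => a.Allowed
  | .jump _ => True
  | .halt => True

/-- The set of all non-empty finite instruction sequences that act on Boolean registers. -/
def ISbr : Set (List Instr) := {X | X ≠ [] ∧ ∀ u ∈ X, u.Allowed}

/-! ### Threads -/

/-- Finite threads: inaction `D`, termination `S`, `tau ∘ x`, and postconditional composition
`x ⊴ a ⊵ y`, written `post x a y`. Composition with the internal action needs only one operand,
by the axiom `x ⊴ tau ⊵ y = tau ∘ x`. -/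
inductive Thread where
  | dead
  | done
  | tau (x : Thread)
  | post (x : Thread) (a : Basic) (y : Thread)

/-- The behaviour of an instruction sequence on execution, if its first `k` instructions are
skipped; inaction if there is no instruction to proceed with. -/
def extractFrom : ℕ → List Instr → Thread
  | _, [] => .dead
  | k + 1, _ :: X => extractFrom k X
  | 0, .plain a :: X => .post (extractFrom 0 X) a (extractFrom 0 X)
  | 0, .ptst a :: X => .post (extractFrom 0 X) a (extractFrom 1 X)
  | 0, .ntst a :: X => .post (extractFrom 1 X) a (extractFrom 0 X)
  | 0, .jump 0 :: _ => .dead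
  | 0, .jump (l + 1) :: X => extractFrom l X
  | 0, .halt :: _ => .done

/-- Thread extraction `|X|`. -/
def extract (X : List Instr) : Thread := extractFrom 0 X

/-! The defining equations of thread extraction. For a one-element sequence `a`, `+a` or `-a`
they are read with `X = []`, where `extract [] = D`. -/

theorem extract_nil : extract [] = .dead := by simp [extract, extractFrom]

theorem extract_plain (a : Basic) (X : List Instr) :
    extract (.plain a :: X) = .post (extract X) a (extract X) := by
  simp [extract, extractFrom]

theorem extract_ptst (a : Basic) (X : List Instr) :
    extract (.ptst a :: X) = .post (extract X) a (extract (.jump 2 :: X)) := by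
  simp [extract, extractFrom]

theorem extract_ntst (a : Basic) (X : List Instr) :
    extract (.ntst a :: X) = .post (extract (.jump 2 :: X)) a (extract X) := by
  simp [extract, extractFrom]

theorem extract_jump_nil (l : ℕ) : extract [.jump l] = .dead := by
  cases l <;> simp [extract, extractFrom]

theorem extract_jump_zero (X : List Instr) : extract (.jump 0 :: X) = .dead := by
  simp [extract, extractFrom]

theorem extract_jump_one (X : List Instr) : extract (.jump 1 :: X) = extract X := by
  simp [extract, extractFrom]

theorem extract_jump_add_two (l : ℕ) (u : Instr) (X : List Instr) :
    extract (.jump (l + 2) :: u :: X) = extract (.jump (l + 1) :: X) := by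
  simp [extract, extractFrom]

theorem extract_halt (X : List Instr) : extract (.halt :: X) = .done := by
  simp [extract, extractFrom]

/-! ### Services -/

/-- Replies of services: a Boolean value or `blocked`. -/
inductive Reply where
  | val (b : Bool)
  | blocked

/-- The empty service and the Boolean register services `BR_b`. -/
inductive Service where
  | empty
  | br (b : Bool)

/-- The service that results from processing a method. -/
def Service.derive : Method → Service → Service
  | _, .empty => .empty
  | .set b, .br _ => .br b
  | .get, .br b => .br b

/-- The reply of a service to a method. -/
def Service.reply : Method → Service → Reply
  | _, .empty => .blocked
  | .set b, .br _ => .val b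
  | .get, .br b => .val b

/-- The use operator: the thread that results from `x` if the service `S` named `f` processes the
basic actions of the form `f.m` that `x` performs. -/
def use (f : Focus) : Thread → Service → Thread
  | .dead, _ => .dead
  | .done, _ => .done
  | .tau x, S => .tau (use f x S)
  | .post x a y, S =>
    if a.focus = f then
      match S.reply a.method with
      | .val true => .tau (use f x (S.derive a.method))
      | .val false => .tau (use f y (S.derive a.method))
      | .blocked => .tau .dead
    else .post (use f x S) a (use f y S)

/-- The apply operator: the service that results from `S`, named `f`, if it processes the basic
actions that the thread `x` performs. -/
def apply (f : Focus) : Thread → Service → Service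
  | .dead, _ => .empty
  | .done, S => S
  | .tau x, S => apply f x S
  | .post x a y, S =>
    if a.focus = f then
      match S.reply a.method with
      | .val true => apply f x (S.derive a.method)
      | .val false => apply f y (S.derive a.method)
      | .blocked => .empty
    else .empty

/-! ### Boolean functions and the non-uniform complexity classes -/

/-- The `n`-ary Boolean functions. -/
abbrev BoolFun (n : ℕ) : Type := (Fin n → Bool) → Bool

/-- Boolean function families. -/
abbrev BoolFamily : Type := (n : ℕ) → BoolFun n

/-- The thread `x` using auxiliary registers `0, …, l-1`, each with content `false`. -/
def useAux (l : ℕ) (x : Thread) : Thread :=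
  (List.range l).foldl (fun p i => use (.aux i) p (.br false)) x

/-- The thread `x` using input registers `0, …, n-1` with contents `b 0, …, b (n-1)`. -/
def useInp {n : ℕ} (b : Fin n → Bool) (x : Thread) : Thread :=
  (List.finRange n).foldl (fun p (i : Fin n) => use (.inp i) p (.br (b i))) x

/-- `X` computes `f`: for some number `l` of auxiliary registers, on every input `b` the output
register, with initial content `false`, ends up with content `f b`. -/
def Computes (X : List Instr) {n : ℕ} (f : BoolFun n) : Prop :=
  ∃ l : ℕ, ∀ b : Fin n → Bool,
    apply .out (useInp b (useAux l (extract X))) (.br false) = .br (f b)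

/-- The class `IS \ FN` of Boolean function families computed by instruction sequences from `IS`
whose lengths are bounded by a function from `FN`. -/
def NUC (IS : Set (List Instr)) (FN : Set (ℕ → ℕ)) : Set BoolFamily :=
  {f | ∃ h ∈ FN, ∀ n, ∃ X ∈ IS, Computes X (f n) ∧ X.length ≤ h n}

/-- The nondeterministic counterpart of `NUC IS FN`. The certificate `c` is appended to the
input `w`. -/
def NDNUC (IS : Set (List Instr)) (FN : Set (ℕ → ℕ)) : Set BoolFamily :=
  {f | ∃ h ∈ FN, Monotone h ∧ ∃ g ∈ NUC IS FN, ∀ (n : ℕ) (w : Fin n → Bool),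
    f n w = true ↔ ∃ c : Fin (h n) → Bool, g (n + h n) (Fin.append w c) = true}

/-- The polynomial functions, i.e. the functions `h` with `h n = O(n ^ k)` for some `k`. -/
def poly : Set (ℕ → ℕ) :=
  {h | ∃ k : ℕ, Asymptotics.IsBigO Filter.atTop (fun n => (h n : ℝ)) (fun n => (n : ℝ) ^ k)}

/-- `f` is `l`-length `IS`-reducible to `g`. -/
def LengthReducible (IS : Set (List Instr)) (l : ℕ) {n m : ℕ} (f : BoolFun n) (g : BoolFun m) :
    Prop :=
  ∃ H : Fin m → BoolFun n,
    (∀ i, ∃ X ∈ IS, Computes X (H i) ∧ X.length ≤ l) ∧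
    ∀ b : Fin n → Bool, f b = g (fun i => H i b)

/-- `f` is non-uniform `FN`-length `IS`-reducible to `g`. -/
def Reducible (IS : Set (List Instr)) (FN : Set (ℕ → ℕ)) (f g : BoolFamily) : Prop :=
  ∃ h ∈ FN, ∀ n, ∃ l m : ℕ, l ≤ h n ∧ m ≤ h n ∧ LengthReducible IS l (f n) (g m)

/-- `f` is complete for the class `NDNUC IS FN`. -/
def NDComplete (IS : Set (List Instr)) (FN : Set (ℕ → ℕ)) (f : BoolFamily) : Prop :=
  f ∈ NDNUC IS FN ∧ ∀ g ∈ NDNUC IS FN, Reducible IS FN g f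

/-! ### The Boolean function family 3SATC -/

/-- Literals over the propositional variables `v_0, v_1, …`: `(i, true)` is `v_i` and
`(i, false)` is its negation. -/
abbrev Literal : Type := ℕ × Bool

/-- The sets of one, two or three literals over the first `k` propositional variables. -/
abbrev Clause (k : ℕ) : Type :=
  {L : Finset Literal // (∀ x ∈ L, x.1 < k) ∧ 1 ≤ L.card ∧ L.card ≤ 3}

/-- The number of disjunctions of at most three literals over `k` variables. -/
def ndisj (k : ℕ) : ℕ := (2 * k).choose 1 + (2 * k).choose 2 + (2 * k).choose 3

theorem ndisj_mono : Monotone ndisj := by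
  intro a b hab
  have h : 2 * a ≤ 2 * b := by omega
  exact add_le_add (add_le_add (Nat.choose_le_choose _ h) (Nat.choose_le_choose _ h))
    (Nat.choose_le_choose _ h)

theorem self_le_ndisj (k : ℕ) : k ≤ ndisj k := by
  simp only [ndisj, Nat.choose_one_right]; omega

theorem ndisj_zero : ndisj 0 = 0 := rfl

/-- The greatest `k` with `ndisj k ≤ n`. -/
def level (n : ℕ) : ℕ := Nat.findGreatest (fun k => ndisj k ≤ n) n

theorem ndisj_level_le (n : ℕ) : ndisj (level n) ≤ n :=
  Nat.findGreatest_spec (P := fun k => ndisj k ≤ n) (Nat.zero_le n) (Nat.zero_le n)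

theorem level_eq {n k : ℕ} (h₁ : ndisj k ≤ n) (h₂ : n < ndisj (k + 1)) : level n = k := by
  refine le_antisymm ?_ (Nat.le_findGreatest ((self_le_ndisj k).trans h₁) h₁)
  by_contra! hlt
  have := ndisj_mono (Nat.succ_le_of_lt hlt)
  have := ndisj_level_le n
  simp only [Nat.succ_eq_add_one] at *
  omega

/-- The conjunction of the disjunctions `α_k(i)` with `b i = true` is satisfiable. -/
def Satisfiable (α : ∀ k, Fin (ndisj k) ≃ Clause k) (k : ℕ) (b : Fin (ndisj k) → Bool) : Prop :=
  ∃ σ : ℕ → Bool, ∀ i, b i = true → ∃ x ∈ (α k i).1, σ x.1 = x.2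

open Classical in
/-- The Boolean function family 3SATC based on the enumerations `α_k` of clauses: with `k`
greatest such that `ndisj k ≤ n`, the first `ndisj k` of the `n` arguments indicate which clauses
occur, and the remaining arguments are ignored. -/
noncomputable def threeSATC (α : ∀ k, Fin (ndisj k) ≃ Clause k) : BoolFamily :=
  fun n b => decide (Satisfiable α (level n) (fun i => b (Fin.castLE (ndisj_level_le n) i)))

end InSeq

/-!
A family in `NPLIS` asks for a certificate `c` with `g (w c)`, where `g` is computed by a short
instruction sequence `X`. Since all jumps lead forward, `X` runs for at most `X.length` steps, so an
execution is recorded by polynomially many Boolean observations: which part of `X` remains after `t`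
steps, and what a register contains after `t` steps. Each observation at time `t + 1` depends on
only two observations at time `t`. Hence an assignment to the observations which agrees with some
accepting execution on any three of them is itself an accepting execution, and agreement on triples
is exactly the truth of all clauses of at most three literals that hold in every accepting
execution. Whether such a clause occurs in the instance of 3SATC is a constant; only the unit
clauses that fix the observed input `w` depend on `w`, so short instruction sequences produce the
whole instance.
-/

namespace InSeq

/-! ### Simultaneous execution with all registers -/

/-- The result of applying a method to a Boolean register with content `c`, which is both the reply
and the new content of the register. -/
def Method.result : Method → Bool → Bool
  | .set b, _ => b
  | .get, c => c

/-- The final service named `out` if `x` is executed with the services `ρ`; a simultaneous version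
of the nested use and apply operators. -/
def exec : Thread → (Focus → Service) → Service
  | .dead, _ => .empty
  | .done, ρ => ρ .out
  | .tau x, ρ => exec x ρ
  | .post x a y, ρ =>
    match (ρ a.focus).reply a.method with
    | .val true => exec x (Function.update ρ a.focus ((ρ a.focus).derive a.method))
    | .val false => exec y (Function.update ρ a.focus ((ρ a.focus).derive a.method))
    | .blocked => .empty

theorem exec_post_of_eq_empty {ρ : Focus → Service} {a : Basic} (h : ρ a.focus = .empty)
    (x y : Thread) : exec (.post x a y) ρ = .empty := by
  simp [exec, h, Service.reply]

theorem exec_post_of_eq_br {ρ : Focus → Service} {a : Basic} {c : Bool} (h : ρ a.focus = .br c)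
    (x y : Thread) :
    exec (.post x a y) ρ = exec (if a.method.result c then x else y)
      (Function.update ρ a.focus (.br (a.method.result c))) := by
  rw [exec, h]
  cases a.method with
  | set b => cases b <;> rfl
  | get => cases c <;> rfl

theorem apply_out_eq_exec (x : Thread) (S : Service) :
    apply .out x S = exec x (Function.update (fun _ => .empty) .out S) := by
  induction x generalizing S with
  | dead => rfl
  | done => simp [apply, exec]
  | tau x ih => simpa [apply, exec] using ih S
  | post x a y ihx ihy =>
    by_cases h : a.focus = .out
    · simp only [apply, exec, h, if_true, Function.update_self, Function.update_idem, ihx, ihy]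
    · simp [apply, exec, h, Service.reply]

theorem exec_use {f : Focus} (hf : f ≠ .out) {ρ : Focus → Service} (hρ : ρ f = .empty)
    (x : Thread) (S : Service) : exec (use f x S) ρ = exec x (Function.update ρ f S) := by
  induction x generalizing S ρ with
  | dead => rfl
  | done => simp [use, exec, Function.update_of_ne hf.symm]
  | tau x ih => simpa [use, exec] using ih hρ S
  | post x a y ihx ihy =>
    by_cases h : a.focus = f
    · subst h
      simp only [use, exec, if_true, Function.update_self, Function.update_idem]
      split <;> simp_all [exec]
    · have hρ' (S' : Service) : Function.update ρ a.focus S' f = .empty := by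
        rw [Function.update_of_ne (Ne.symm h), hρ]
      simp only [use, exec, h, if_false, Function.update_of_ne h, ihx (hρ' _), ihy (hρ' _),
        Function.update_comm h]

theorem exec_foldl_use {ι : Type*} (nm : ι → Focus) (S : ι → Service) {is : List ι}
    (hnd : (is.map nm).Nodup) (hout : ∀ i, nm i ≠ .out) {ρ ρ' : Focus → Service}
    (hρ : ∀ i ∈ is, ρ (nm i) = .empty) (hmem : ∀ i ∈ is, ρ' (nm i) = S i)
    (hnotMem : ∀ f ∉ is.map nm, ρ' f = ρ f) (x : Thread) :
    exec (is.foldl (fun p i => use (nm i) p (S i)) x) ρ = exec x ρ' := by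
  induction is generalizing x ρ' with
  | nil => rw [show ρ' = ρ from funext fun f => hnotMem f List.not_mem_nil]; rfl
  | cons i is ih =>
    simp only [List.map_cons, List.nodup_cons, List.mem_cons, not_or, and_imp,
      forall_eq_or_imp] at hnd hρ hmem hnotMem
    have hrest : exec (is.foldl (fun p i => use (nm i) p (S i)) (use (nm i) x (S i))) ρ =
        exec (use (nm i) x (S i)) (Function.update ρ' (nm i) .empty) := by
      refine ih hnd.2 hρ.2 (fun j hj => ?_) (fun f hf => ?_) _
      · rw [Function.update_of_ne (ne_of_mem_of_not_mem (List.mem_map_of_mem hj) hnd.1),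
          hmem.2 j hj]
      · rcases eq_or_ne f (nm i) with rfl | hfi
        · rw [Function.update_self, hρ.1]
        · rw [Function.update_of_ne hfi, hnotMem f hfi hf]
    rw [List.foldl_cons, hrest, exec_use (hout i) (Function.update_self ..), Function.update_idem,
      ← hmem.1, Function.update_eq_self]

/-- The services at the start of an execution with input `b` and `l` auxiliary registers. -/
def initServices {n : ℕ} (b : Fin n → Bool) (l : ℕ) : Focus → Service
  | .inp i => if h : i < n then .br (b ⟨i, h⟩) else .empty
  | .aux i => if i < l then .br false else .empty
  | .out => .br false

theorem apply_useInp_useAux {n : ℕ} (b : Fin n → Bool) (l : ℕ) (x : Thread) :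
    apply .out (useInp b (useAux l x)) (.br false) = exec x (initServices b l) := by
  have hinp : Function.Injective fun i : Fin n => Focus.inp i := fun i j h => by
    simpa [Fin.ext_iff] using h
  have haux : Function.Injective Focus.aux := fun i j h => by simpa using h
  calc apply .out (useInp b (useAux l x)) (.br false)
      = exec (useInp b (useAux l x)) (Function.update (fun _ => .empty) .out (.br false)) :=
        apply_out_eq_exec _ _
    _ = exec (useAux l x) (initServices b 0) := by
      refine exec_foldl_use (fun i : Fin n => Focus.inp i) (fun i => .br (b i))
        ((List.nodup_finRange n).map hinp) (by simp) (by simp) (by simp [initServices]) ?_ _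
      rintro (i | i | _) hf
      · have hi : ¬ i < n := fun hi => hf (List.mem_map.2 ⟨⟨i, hi⟩, by simp⟩)
        simp [initServices, hi]
      · simp [initServices]
      · simp [initServices]
    _ = exec x (initServices b l) := by
      refine exec_foldl_use Focus.aux (fun _ => .br false) (List.nodup_range.map haux) (by simp)
        (by simp [initServices]) (by simp [initServices]) ?_ _
      rintro (i | i | _) hf
      · rfl
      · have hi : ¬ i < l := by simpa using hf
        simp [initServices, hi]
      · rfl

theorem computes_iff_exec {X : List Instr} {n : ℕ} {f : BoolFun n} :
    Computes X f ↔ ∃ l, ∀ b, exec (extract X) (initServices b l) = .br (f b) := by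
  simp only [Computes, apply_useInp_useAux]

/-! ### Computing formulas in conjunctive normal form -/

section CNF

variable {n : ℕ}

/-- The test of a literal over the input registers. -/
def litTest (x : Fin n × Bool) : Instr :=
  if x.2 then .ptst ⟨.inp x.1, .get⟩ else .ntst ⟨.inp x.1, .get⟩

/-- Code for a disjunction of literals, which proceeds after its end if the disjunction holds and
terminates otherwise. -/
def clauseCode : List (Fin n × Bool) → List Instr
  | [] => [.halt]
  | x :: c => litTest x :: .jump ((clauseCode c).length + 1) :: clauseCode c

/-- Code that computes a formula in conjunctive normal form over the input registers. -/
def cnfCode : List (List (Fin n × Bool)) → List Instr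
  | [] => [.plain ⟨.out, .set true⟩, .halt]
  | c :: cs => clauseCode c ++ cnfCode cs

theorem extractFrom_length_append (X Y : List Instr) :
    extractFrom X.length (X ++ Y) = extract Y := by
  induction X with
  | nil => rfl
  | cons u X ih => simpa only [List.length_cons, List.cons_append, extractFrom] using ih

theorem exec_litTest {ρ : Focus → Service} {x : Fin n × Bool} {v : Bool}
    (hρ : ρ (.inp x.1) = .br v) (X : List Instr) :
    exec (extract (litTest x :: X)) ρ =
      if v = x.2 then exec (extract X) ρ else exec (extractFrom 1 X) ρ := by
  obtain ⟨i, p⟩ := x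
  have hρv : Function.update ρ (.inp i) (.br v) = ρ := by rw [← hρ, Function.update_eq_self]
  have hpost (y z : Thread) : exec (.post y ⟨.inp i, .get⟩ z) ρ = exec (if v then y else z) ρ := by
    rw [exec_post_of_eq_br hρ, Method.result, hρv]
  cases p <;> cases v <;> simp [litTest, extract, extractFrom, hpost]

theorem exec_clauseCode {ρ : Focus → Service} {b : Fin n → Bool}
    (hρ : ∀ i : Fin n, ρ (.inp i) = .br (b i)) (c : List (Fin n × Bool)) (X : List Instr) :
    exec (extract (clauseCode c ++ X)) ρ =
      if ∃ x ∈ c, b x.1 = x.2 then exec (extract X) ρ else ρ .out := by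
  induction c with
  | nil => simp [clauseCode, extract_halt, exec]
  | cons x c ih =>
    have hskip : extract (.jump ((clauseCode c).length + 1) :: (clauseCode c ++ X)) = extract X :=
      extractFrom_length_append _ _
    have hnext : extractFrom 1 (.jump ((clauseCode c).length + 1) :: (clauseCode c ++ X)) =
        extract (clauseCode c ++ X) := rfl
    simp only [clauseCode, List.cons_append, exec_litTest (hρ x.1), hskip, hnext, ih,
      List.exists_mem_cons_iff, ite_or]

theorem exec_cnfCode {ρ : Focus → Service} {b : Fin n → Bool}
    (hρ : ∀ i : Fin n, ρ (.inp i) = .br (b i)) (hout : ρ .out = .br false)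
    (cs : List (List (Fin n × Bool))) :
    exec (extract (cnfCode cs)) ρ = .br (decide (∀ c ∈ cs, ∃ x ∈ c, b x.1 = x.2)) := by
  induction cs with
  | nil => simp [cnfCode, extract, extractFrom, exec, hout, Service.reply, Service.derive]
  | cons c cs ih =>
    rw [cnfCode, exec_clauseCode hρ, ih, hout]
    split_ifs with h
    · simp only [List.forall_mem_cons, h, true_and]
    · simp only [List.forall_mem_cons, h, false_and, decide_false]

theorem computes_cnfCode {f : BoolFun n} {cs : List (List (Fin n × Bool))}
    (hf : ∀ b, f b = true ↔ ∀ c ∈ cs, ∃ x ∈ c, b x.1 = x.2) : Computes (cnfCode cs) f := by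
  refine computes_iff_exec.2 ⟨0, fun b => ?_⟩
  rw [exec_cnfCode (b := b) (fun i => by simp [initServices]) rfl]
  exact congrArg Service.br (by rw [Bool.eq_iff_iff, hf b, decide_eq_true_iff])

theorem length_clauseCode (c : List (Fin n × Bool)) :
    (clauseCode c).length = 2 * c.length + 1 := by
  induction c with
  | nil => rfl
  | cons x c ih => simp only [clauseCode, List.length_cons, ih]; omega

theorem length_cnfCode_le {cs : List (List (Fin n × Bool))} {k : ℕ}
    (h : ∀ c ∈ cs, c.length ≤ k) : (cnfCode cs).length ≤ (2 * k + 1) * cs.length + 2 := by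
  induction cs with
  | nil => simp [cnfCode]
  | cons c cs ih =>
    rw [List.forall_mem_cons] at h
    have := ih h.2
    rw [cnfCode, List.length_append, length_clauseCode, List.length_cons, mul_add]
    omega

theorem allowed_of_mem_clauseCode {c : List (Fin n × Bool)} : ∀ u ∈ clauseCode c, u.Allowed := by
  induction c with
  | nil => simp [clauseCode, Instr.Allowed]
  | cons x c ih =>
    have hx : (litTest x).Allowed := by unfold litTest; split_ifs <;> trivial
    simp only [clauseCode, List.forall_mem_cons]
    exact ⟨hx, trivial, ih⟩

theorem cnfCode_mem_ISbr (cs : List (List (Fin n × Bool))) : cnfCode cs ∈ ISbr := by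
  induction cs with
  | nil => simp [cnfCode, ISbr, Instr.Allowed, Basic.Allowed]
  | cons c cs ih =>
    refine ⟨List.append_ne_nil_of_right_ne_nil _ ih.1, ?_⟩
    exact List.forall_mem_append.2 ⟨allowed_of_mem_clauseCode, ih.2⟩

end CNF

/-! ### Polynomially bounded functions -/

theorem monotone_polynomial_eval (p : Polynomial ℕ) : Monotone fun n => p.eval n := by
  intro m n hmn
  simp only [Polynomial.eval_eq_sum_range]
  gcongr

theorem mem_poly_iff {h : ℕ → ℕ} : h ∈ poly ↔ ∃ p : Polynomial ℕ, ∀ n, h n ≤ p.eval n := by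
  constructor
  · rintro ⟨k, hk⟩
    obtain ⟨c, hc⟩ := hk.bound
    obtain ⟨N, hN⟩ := Filter.eventually_atTop.1 hc
    refine ⟨.C ⌈c⌉₊ * .X ^ k + .C (∑ i ∈ Finset.range N, h i), fun n => ?_⟩
    simp only [Polynomial.eval_add, Polynomial.eval_mul, Polynomial.eval_C, Polynomial.eval_pow,
      Polynomial.eval_X]
    rcases lt_or_ge n N with hn | hn
    · exact (Finset.single_le_sum (f := h) (fun _ _ => Nat.zero_le _)
        (Finset.mem_range.2 hn)).trans (Nat.le_add_left _ _)
    · refine le_add_right (Nat.cast_le (α := ℝ).1 ?_)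
      calc (h n : ℝ) ≤ c * n ^ k := by simpa using hN n hn
        _ ≤ ⌈c⌉₊ * n ^ k := by gcongr; exact Nat.le_ceil c
        _ = ((⌈c⌉₊ * n ^ k : ℕ) : ℝ) := by push_cast; rfl
  · rintro ⟨p, hp⟩
    have hdeg : (p.map (Nat.castRingHom ℝ)).degree ≤
        (Polynomial.X ^ p.natDegree : Polynomial ℝ).degree := by
      rw [Polynomial.degree_X_pow]
      exact Polynomial.degree_map_le.trans Polynomial.degree_le_natDegree
    have hpO : Asymptotics.IsBigO Filter.atTop (fun n => ((p.eval n : ℕ) : ℝ))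
        fun n => (n : ℝ) ^ p.natDegree := by
      simpa only [Function.comp_def, Polynomial.eval_natCast_map, eq_natCast, Nat.cast_id,
        Polynomial.eval_pow, Polynomial.eval_X] using
        (Polynomial.isBigO_atTop_of_degree_le _ _ hdeg).comp_tendsto tendsto_natCast_atTop_atTop
    exact ⟨p.natDegree, .trans (.of_norm_le fun n => by simpa using hp n) hpO⟩

theorem const_mem_poly (c : ℕ) : (fun _ => c) ∈ poly :=
  mem_poly_iff.2 ⟨.C c, by simp⟩

theorem id_mem_poly : (fun n => n) ∈ poly :=
  mem_poly_iff.2 ⟨.X, by simp⟩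

theorem add_mem_poly {f g : ℕ → ℕ} (hf : f ∈ poly) (hg : g ∈ poly) :
    (fun n => f n + g n) ∈ poly := by
  obtain ⟨p, hp⟩ := mem_poly_iff.1 hf
  obtain ⟨q, hq⟩ := mem_poly_iff.1 hg
  exact mem_poly_iff.2 ⟨p + q, fun n => by
    simpa only [Polynomial.eval_add] using add_le_add (hp n) (hq n)⟩

theorem mul_mem_poly {f g : ℕ → ℕ} (hf : f ∈ poly) (hg : g ∈ poly) :
    (fun n => f n * g n) ∈ poly := by
  obtain ⟨p, hp⟩ := mem_poly_iff.1 hf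
  obtain ⟨q, hq⟩ := mem_poly_iff.1 hg
  exact mem_poly_iff.2 ⟨p * q, fun n => by
    simpa only [Polynomial.eval_mul] using Nat.mul_le_mul (hp n) (hq n)⟩

theorem comp_mem_poly {f g : ℕ → ℕ} (hf : f ∈ poly) (hg : g ∈ poly) :
    (fun n => f (g n)) ∈ poly := by
  obtain ⟨p, hp⟩ := mem_poly_iff.1 hf
  obtain ⟨q, hq⟩ := mem_poly_iff.1 hg
  exact mem_poly_iff.2 ⟨p.comp q, fun n => by
    simpa only [Polynomial.eval_comp] using (hp (g n)).trans (monotone_polynomial_eval p (hq n))⟩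

theorem ndisj_mem_poly : ndisj ∈ poly := by
  refine mem_poly_iff.2 ⟨(2 * .X) ^ 1 + (2 * .X) ^ 2 + (2 * .X) ^ 3, fun k => ?_⟩
  simp only [Polynomial.eval_add, Polynomial.eval_pow, Polynomial.eval_mul, Polynomial.eval_ofNat,
    Polynomial.eval_X]
  exact add_le_add (add_le_add (Nat.choose_le_pow _ _) (Nat.choose_le_pow _ _))
    (Nat.choose_le_pow _ _)

/-! ### Membership of 3SATC in NPLIS -/

theorem singleton_halt_mem_ISbr : [.halt] ∈ ISbr := by
  simp [ISbr, Instr.Allowed]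

theorem computes_singleton_halt {n : ℕ} : Computes [.halt] (fun _ : Fin n → Bool => false) :=
  computes_iff_exec.2 ⟨0, fun _ => by rw [extract_halt]; rfl⟩

/-- As `n ↦ n + h n` is injective, verifiers chosen separately for each `n` form one family. -/
theorem mem_NDNUC_of_verifier {f : BoolFamily} {h p : ℕ → ℕ} (hh : h ∈ poly) (hmono : Monotone h)
    (hp : p ∈ poly) (g : ∀ n, BoolFun (n + h n))
    (hg : ∀ n, ∃ X ∈ ISbr, Computes X (g n) ∧ X.length ≤ p (n + h n))
    (hfg : ∀ n w, f n w = true ↔ ∃ c, g n (Fin.append w c) = true) :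
    f ∈ NDNUC ISbr poly := by
  classical
  have hinj : Function.Injective fun n => n + h n := (strictMono_id.add_monotone hmono).injective
  let G : BoolFamily := fun m b =>
    decide (∃ (n : ℕ) (e : n + h n = m), g n (b ∘ Fin.cast e) = true)
  have hG : ∀ n, G (n + h n) = g n := fun n => funext fun b => by
    rw [Bool.eq_iff_iff, decide_eq_true_iff]
    constructor
    · rintro ⟨n', e, hb⟩
      obtain rfl := hinj e
      exact hb
    · exact fun hb => ⟨n, rfl, hb⟩
  refine ⟨h, hh, hmono, G, ⟨_, add_mem_poly hp (const_mem_poly 1), fun m => ?_⟩, fun n w => ?_⟩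
  · by_cases hm : ∃ n, n + h n = m
    · obtain ⟨n, rfl⟩ := hm
      obtain ⟨X, hX, hXg, hlen⟩ := hg n
      exact ⟨X, hX, (hG n).symm ▸ hXg, Nat.le_succ_of_le hlen⟩
    · have hGm : G m = fun _ => false := funext fun b =>
        decide_eq_false fun ⟨n, e, _⟩ => hm ⟨n, e⟩
      exact ⟨[.halt], singleton_halt_mem_ISbr, hGm ▸ computes_singleton_halt, Nat.le_add_left _ _⟩
  · rw [hG, hfg]

theorem level_le (n : ℕ) : level n ≤ n := Nat.findGreatest_le n

theorem Clause.lt_of_mem {n : ℕ} (C : Clause (level n)) (x : {x // x ∈ C.1}) : x.1.1 < n :=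
  (C.2.1 x.1 x.2).trans_le (level_le n)

/-- The formula in conjunctive normal form that checks whether the assignment given by the last `n`
inputs satisfies the formula given by the first `n` inputs. -/
noncomputable def verifierCNF (α : ∀ k, Fin (ndisj k) ≃ Clause k) (n : ℕ) :
    List (List (Fin (n + n) × Bool)) :=
  (List.finRange (ndisj (level n))).map fun i =>
    (Fin.castAdd n (Fin.castLE (ndisj_level_le n) i), false) ::
      (α (level n) i).1.attach.toList.map fun x =>
        (Fin.natAdd n ⟨x.1.1, (α (level n) i).lt_of_mem x⟩, x.1.2)

theorem length_cnfCode_verifierCNF_le (α : ∀ k, Fin (ndisj k) ≃ Clause k) (n : ℕ) :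
    (cnfCode (verifierCNF α n)).length ≤ 9 * (n + n) + 2 := by
  have hclause : ∀ c ∈ verifierCNF α n, c.length ≤ 4 := by
    simp only [verifierCNF, List.mem_map, List.mem_finRange, true_and, forall_exists_index,
      forall_apply_eq_imp_iff, List.length_cons, List.length_map, Finset.length_toList,
      Finset.card_attach]
    exact fun i => Nat.succ_le_succ (α (level n) i).2.2.2
  have hlen : (verifierCNF α n).length ≤ n := by
    simpa only [verifierCNF, List.length_map, List.length_finRange] using ndisj_level_le n
  have := length_cnfCode_le hclause
  omega

theorem verifierCNF_append_iff (α : ∀ k, Fin (ndisj k) ≃ Clause k) {n : ℕ} (w : Fin n → Bool)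
    (σ : ℕ → Bool) :
    (∀ c ∈ verifierCNF α n, ∃ x ∈ c, Fin.append w (σ ∘ Fin.val) x.1 = x.2) ↔
      ∀ i, w (Fin.castLE (ndisj_level_le n) i) = true →
        ∃ x ∈ (α (level n) i).1, σ x.1 = x.2 := by
  simp only [verifierCNF, List.mem_map, List.mem_finRange, true_and, forall_exists_index,
    forall_apply_eq_imp_iff, List.exists_mem_cons_iff, Fin.append_left, exists_exists_eq_and,
    Finset.mem_toList, Finset.mem_attach, Fin.append_right, Function.comp_apply,
    ← Bool.not_eq_true, ← imp_iff_not_or]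
  simp only [Subtype.exists, exists_prop]

theorem threeSATC_mem_NDNUC (α : ∀ k, Fin (ndisj k) ≃ Clause k) :
    threeSATC α ∈ NDNUC ISbr poly := by
  classical
  let g (n : ℕ) : BoolFun (n + n) := fun b => decide (∀ c ∈ verifierCNF α n, ∃ x ∈ c, b x.1 = x.2)
  refine mem_NDNUC_of_verifier id_mem_poly monotone_id
    (add_mem_poly (mul_mem_poly (const_mem_poly 9) id_mem_poly) (const_mem_poly 2)) g
    (fun n => ⟨_, cnfCode_mem_ISbr _, computes_cnfCode fun b => decide_eq_true_iff,
      length_cnfCode_verifierCNF_le α n⟩) fun n w => ?_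
  have hsurj : Function.Surjective fun (σ : ℕ → Bool) (i : Fin n) => σ i :=
    Fin.val_injective.surjective_comp_right
  calc threeSATC α n w = true
      ↔ ∃ σ : ℕ → Bool, ∀ i, w (Fin.castLE (ndisj_level_le n) i) = true →
          ∃ x ∈ (α (level n) i).1, σ x.1 = x.2 := decide_eq_true_iff
    _ ↔ ∃ σ : ℕ → Bool, g n (Fin.append w (σ ∘ Fin.val)) = true := by
        simp only [g, decide_eq_true_iff, verifierCNF_append_iff]
    _ ↔ ∃ c : Fin n → Bool, g n (Fin.append w c) = true :=
        (hsurj.exists (p := fun c => g n (Fin.append w c) = true)).symm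

/-! ### Agreement on triples -/

section TripleClosure

variable {ι : Type*}

/-- The assignments that agree on any three variables with a member of `A`; these are the models of
all clauses of at most three literals that hold throughout `A`. -/
def tripleClosure (A : Set (ι → Bool)) : Set (ι → Bool) :=
  {σ | ∀ u v w, ∃ τ ∈ A, τ u = σ u ∧ τ v = σ v ∧ τ w = σ w}

theorem tripleClosure_mono {A B : Set (ι → Bool)} (h : A ⊆ B) :
    tripleClosure A ⊆ tripleClosure B := fun _ hσ u v w =>
  let ⟨τ, hτ, hτσ⟩ := hσ u v w
  ⟨τ, h hτ, hτσ⟩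

theorem eq_of_mem_tripleClosure {A : Set (ι → Bool)} {σ : ι → Bool} (hσ : σ ∈ tripleClosure A)
    (u v : ι) {w : ι} {r : Bool} (h : ∀ τ ∈ A, τ u = σ u → τ v = σ v → τ w = r) : σ w = r := by
  obtain ⟨τ, hτ, hu, hv, hw⟩ := hσ u v w
  rw [← hw, h τ hτ hu hv]

theorem comp_mem_tripleClosure {k : ℕ} {code : ι → ℕ} (hcode : ∀ u, code u < k)
    {A : Set (ι → Bool)} {σ : ℕ → Bool}
    (h : ∀ C : Clause k, (∀ τ : ℕ → Bool, τ ∘ code ∈ A → ∃ x ∈ C.1, τ x.1 = x.2) →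
      ∃ x ∈ C.1, σ x.1 = x.2) : σ ∘ code ∈ tripleClosure A := by
  intro u v w
  by_contra! hne
  obtain ⟨x, hx, hσx⟩ := h
    ⟨{(code u, !σ (code u)), (code v, !σ (code v)), (code w, !σ (code w))},
      by simp [hcode], Finset.card_pos.2 (Finset.insert_nonempty _ _), Finset.card_le_three⟩
    fun τ hτ => by
      by_contra! hτne
      simp only [Finset.mem_insert, Finset.mem_singleton, forall_eq_or_imp, forall_eq, ne_eq,
        Bool.not_eq_not] at hτne
      exact hne _ hτ hτne.1 hτne.2.1 hτne.2.2
  simp only [Finset.mem_insert, Finset.mem_singleton] at hx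
  rcases hx with rfl | rfl | rfl <;> simp at hσx

/-- `g⁻¹(true)` is the projection of both `A` and `tripleClosure A` to the variables `inp i`. -/
def Represents {n : ℕ} (A : Set (ι → Bool)) (inp : Fin n → ι) (g : BoolFun n) : Prop :=
  (∀ b, g b = true → ∃ τ ∈ A, τ ∘ inp = b) ∧ ∀ σ ∈ tripleClosure A, g (σ ∘ inp) = true

theorem Represents.exists_append {n m : ℕ} {A : Set (ι → Bool)} {inp : Fin (n + m) → ι}
    {g : BoolFun (n + m)} (hg : Represents A inp g) {f : BoolFun n}
    (hfg : ∀ w, f w = true ↔ ∃ c : Fin m → Bool, g (Fin.append w c) = true) :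
    Represents A (inp ∘ Fin.castAdd m) f := by
  refine ⟨fun w hw => ?_, fun σ hσ => (hfg _).2 ⟨σ ∘ inp ∘ Fin.natAdd n, ?_⟩⟩
  · obtain ⟨c, hc⟩ := (hfg w).1 hw
    obtain ⟨τ, hτ, hτc⟩ := hg.1 _ hc
    exact ⟨τ, hτ, funext fun i => by
      rw [← Function.comp_assoc, hτc, Function.comp_apply, Fin.append_left]⟩
  · have happend : Fin.append (σ ∘ inp ∘ Fin.castAdd m) (σ ∘ inp ∘ Fin.natAdd n) = σ ∘ inp :=
      Fin.append_castAdd_natAdd (f := σ ∘ inp)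
    rw [happend]
    exact hg.2 σ hσ

end TripleClosure

/-! ### Instances of 3SATC from agreement on triples -/

theorem ndisj_lt_succ (k : ℕ) : ndisj k < ndisj (k + 1) := by
  have h : 2 * k ≤ 2 * (k + 1) := by omega
  have h₂ := Nat.choose_le_choose 2 h
  have h₃ := Nat.choose_le_choose 3 h
  simp only [ndisj, Nat.choose_one_right] at *
  omega

theorem level_ndisj (k : ℕ) : level (ndisj k) = k := level_eq le_rfl (ndisj_lt_succ k)

theorem threeSATC_ndisj (α : ∀ k, Fin (ndisj k) ≃ Clause k) (k : ℕ) (b : Fin (ndisj k) → Bool) :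
    threeSATC α (ndisj k) b = true ↔ Satisfiable α k b := by
  suffices ∀ (j : ℕ) (hle : ndisj j ≤ ndisj k), j = k →
      (Satisfiable α j (fun i => b (Fin.castLE hle i)) ↔ Satisfiable α k b) by
    simpa only [threeSATC, decide_eq_true_iff] using this _ (ndisj_level_le _) (level_ndisj k)
  rintro j hle rfl
  rfl

section Selector

variable {n : ℕ}

open Classical in
/-- The Boolean function that decides whether the clause `C` occurs in the formula for the input
`w`, which consists of the clauses that hold throughout `B` and of the unit clauses that give the
variables `v i` the values `w i`. -/
noncomputable def selector (B : Set (ℕ → Bool)) (v : Fin n → ℕ) (C : Finset Literal) : BoolFun n :=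
  fun w => decide ((∀ σ ∈ B, ∃ x ∈ C, σ x.1 = x.2) ∨ ∃ i, C = {(v i, w i)})

theorem exists_computes_selector (B : Set (ℕ → Bool)) {v : Fin n → ℕ} (hv : Function.Injective v)
    (C : Finset Literal) : ∃ X ∈ ISbr, Computes X (selector B v C) ∧ X.length ≤ 5 := by
  suffices ∃ cs : List (List (Fin n × Bool)), cs.length ≤ 1 ∧ (∀ c ∈ cs, c.length ≤ 1) ∧
      ∀ w, selector B v C w = true ↔ ∀ c ∈ cs, ∃ x ∈ c, w x.1 = x.2 by
    obtain ⟨cs, hcs, hclause, hcomp⟩ := this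
    have := length_cnfCode_le hclause
    exact ⟨cnfCode cs, cnfCode_mem_ISbr cs, computes_cnfCode hcomp, by omega⟩
  simp only [selector, decide_eq_true_iff]
  by_cases hB : ∀ σ ∈ B, ∃ x ∈ C, σ x.1 = x.2
  · exact ⟨[], by simp, by simp, fun w => by simp only [List.not_mem_nil]; tauto⟩
  simp only [hB, false_or]
  by_cases hunit : ∃ i p, C = {(v i, p)}
  · obtain ⟨i, p, rfl⟩ := hunit
    refine ⟨[[(i, p)]], by simp, by simp, fun w => ?_⟩
    simp [hv.eq_iff, eq_comm]
  · exact ⟨[[]], by simp, by simp, fun w => by simpa using fun i hi => hunit ⟨i, _, hi⟩⟩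

end Selector

theorem Represents.lengthReducible_threeSATC {ι : Type*} [Fintype ι] {n : ℕ} {A : Set (ι → Bool)}
    {inp : Fin n → ι} {f : BoolFun n} (hf : Represents A inp f) (hinp : Function.Injective inp)
    (α : ∀ k, Fin (ndisj k) ≃ Clause k) :
    LengthReducible ISbr 5 f (threeSATC α (ndisj (Fintype.card ι))) := by
  let code : ι → ℕ := fun u => Fintype.equivFin ι u
  have hcode : Function.Injective code := Fin.val_injective.comp (Fintype.equivFin ι).injective
  have hlt : ∀ u, code u < Fintype.card ι := fun u => (Fintype.equivFin ι u).2
  let B : Set (ℕ → Bool) := {σ | σ ∘ code ∈ A}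
  refine ⟨fun j => selector B (code ∘ inp) (α _ j).1,
    fun j => exists_computes_selector B (hcode.comp hinp) _, fun w => ?_⟩
  rw [Bool.eq_iff_iff, threeSATC_ndisj]
  simp only [Satisfiable, selector, decide_eq_true_iff]
  constructor
  · intro hw
    obtain ⟨τ, hτ, rfl⟩ := hf.1 w hw
    obtain ⟨σ, rfl⟩ := hcode.surjective_comp_right τ
    refine ⟨σ, fun j hj => ?_⟩
    obtain hB | ⟨i, hi⟩ := hj
    · exact hB σ hτ
    · exact ⟨_, hi ▸ Finset.mem_singleton_self _, rfl⟩
  · rintro ⟨σ, hσ⟩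
    have hσC : ∀ C : Clause _, ((∀ τ ∈ B, ∃ x ∈ C.1, τ x.1 = x.2) ∨
        ∃ i, C.1 = {(code (inp i), w i)}) → ∃ x ∈ C.1, σ x.1 = x.2 :=
      (α _).surjective.forall.2 hσ
    have hw : (σ ∘ code) ∘ inp = w := funext fun i => by
      simpa using hσC ⟨{(code (inp i), w i)}, by simp [hlt], by simp, by simp⟩ (Or.inr ⟨i, rfl⟩)
    rw [← hw]
    exact hf.2 _ (comp_mem_tripleClosure hlt fun C hC => hσC C (Or.inl hC))

/-! ### Observing executions -/

/-- The register on which the first action of a thread operates; `out` by convention if the thread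
does not start with a basic action. -/
def Thread.focus : Thread → Focus
  | .post _ a _ => a.focus
  | _ => .out

/-- The register on which an instruction operates; `out` by convention for jumps and termination. -/
def Instr.focus : Instr → Focus
  | .plain a => a.focus
  | .ptst a => a.focus
  | .ntst a => a.focus
  | _ => .out

/-- The maximal number of steps of a thread. -/
def Thread.depth : Thread → ℕ
  | .dead => 0
  | .done => 0
  | .tau x => x.depth + 1
  | .post x _ y => max x.depth y.depth + 1

/-- One step of an execution in which every register is available; threads that cannot proceed
remain as they are. -/
def step : Thread × (Focus → Bool) → Thread × (Focus → Bool)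
  | (.tau x, s) => (x, s)
  | (.post x a y, s) =>
    (if a.method.result (s a.focus) then x else y,
      Function.update s a.focus (a.method.result (s a.focus)))
  | (x, s) => (x, s)

theorem step_fst_congr {x : Thread} {s s' : Focus → Bool} (h : s x.focus = s' x.focus) :
    (step (x, s)).1 = (step (x, s')).1 := by
  cases x with
  | post x a y => simp only [step, show s a.focus = s' a.focus from h]
  | _ => rfl

theorem step_snd_congr (x : Thread) {f : Focus} {s s' : Focus → Bool} (h : s f = s' f) :
    (step (x, s)).2 f = (step (x, s')).2 f := by
  cases x with
  | post x a y =>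
    rcases eq_or_ne f a.focus with rfl | hf
    · simp only [step, Function.update_self, h]
    · simp only [step, Function.update_of_ne hf, h]
  | _ => exact h

theorem iterate_step_out_of_exec {x : Thread} {ρ : Focus → Service} {s : Focus → Bool} {v : Bool}
    {t : ℕ} (hs : ∀ f c, ρ f = .br c → s f = c) (hx : exec x ρ = .br v) (ht : x.depth ≤ t) :
    (step^[t] (x, s)).2 .out = v := by
  induction x generalizing ρ s t with
  | dead => cases hx
  | done => rw [Function.iterate_fixed rfl]; exact hs _ _ hx
  | tau x ih =>
    obtain ⟨t, rfl⟩ := Nat.exists_eq_add_of_le' ((Nat.le_add_left 1 _).trans ht)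
    exact ih hs hx (Nat.le_of_succ_le_succ ht)
  | post x a y ihx ihy =>
    obtain ⟨t, rfl⟩ := Nat.exists_eq_add_of_le' ((Nat.le_add_left 1 _).trans ht)
    obtain ⟨hxt, hyt⟩ := max_le_iff.1 (Nat.le_of_succ_le_succ ht)
    cases hρ : ρ a.focus with
    | empty => rw [exec_post_of_eq_empty hρ] at hx; cases hx
    | br c =>
      obtain rfl := hs _ _ hρ
      rw [exec_post_of_eq_br hρ] at hx
      have hs' : ∀ f c, Function.update ρ a.focus (.br (a.method.result (s a.focus))) f = .br c →
          Function.update s a.focus (a.method.result (s a.focus)) f = c := fun f c hf => by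
        rcases eq_or_ne f a.focus with rfl | hfa
        · simpa using hf
        · rw [Function.update_of_ne hfa] at hf ⊢
          exact hs f c hf
      rw [Function.iterate_succ_apply, step]
      split_ifs at hx ⊢
      · exact ihx hs' hx hxt
      · exact ihy hs' hx hyt

theorem extractFrom_of_length_le {X : List Instr} {k : ℕ} (h : X.length ≤ k) :
    extractFrom k X = .dead := by
  induction X generalizing k with
  | nil => rw [extractFrom]
  | cons u X ih =>
    obtain ⟨k, rfl⟩ := Nat.exists_eq_add_of_le' ((Nat.le_add_left 1 _).trans h)
    exact ih (Nat.le_of_succ_le_succ h)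

theorem extractFrom_ne_tau (X : List Instr) (k : ℕ) (x : Thread) : extractFrom k X ≠ .tau x := by
  fun_induction extractFrom k X <;> simp_all

theorem exists_of_extractFrom_eq_post {X : List Instr} {k : ℕ} {x y : Thread} {a : Basic}
    (h : extractFrom k X = .post x a y) :
    a.focus ∈ X.map Instr.focus ∧
      ∃ i > k, ∃ j > k, x = extractFrom i X ∧ y = extractFrom j X := by
  fun_induction extractFrom k X with
  | case2 k u X ih | case7 k X ih =>
    obtain ⟨ha, i, hi, j, hj, hx, hy⟩ := ih h
    exact ⟨List.mem_cons_of_mem _ ha, i + 1, by omega, j + 1, by omega, hx, hy⟩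
  | case3 a X =>
    cases h
    exact ⟨List.mem_cons_self, 1, one_pos, 1, one_pos, rfl, rfl⟩
  | case4 a X =>
    cases h
    exact ⟨List.mem_cons_self, 1, one_pos, 2, two_pos, rfl, rfl⟩
  | case5 a X =>
    cases h
    exact ⟨List.mem_cons_self, 2, two_pos, 1, one_pos, rfl, rfl⟩
  | case1 | case6 | case8 => cases h

theorem depth_extractFrom_le (X : List Instr) (k : ℕ) :
    (extractFrom k X).depth ≤ X.length - k := by
  induction hm : X.length - k using Nat.strong_induction_on generalizing k with
  | _ m ih =>
    subst hm
    cases h : extractFrom k X with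
    | dead => exact Nat.zero_le _
    | done => exact Nat.zero_le _
    | tau x => exact absurd h (extractFrom_ne_tau X k x)
    | post x a y =>
      have hk : k < X.length := by
        by_contra! hk
        rw [extractFrom_of_length_le hk] at h
        cases h
      obtain ⟨-, i, hi, j, hj, rfl, rfl⟩ := exists_of_extractFrom_eq_post h
      have hdi := ih _ (by omega) i rfl
      have hdj := ih _ (by omega) j rfl
      rw [Thread.depth]
      omega

theorem exists_step_extractFrom (X : List Instr) (k : ℕ) (s : Focus → Bool) :
    ∃ k', (step (extractFrom k X, s)).1 = extractFrom k' X := by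
  cases h : extractFrom k X with
  | dead => exact ⟨k, h.symm⟩
  | done => exact ⟨k, h.symm⟩
  | tau x => exact absurd h (extractFrom_ne_tau X k x)
  | post x a y =>
    obtain ⟨-, i, -, j, -, rfl, rfl⟩ := exists_of_extractFrom_eq_post h
    rw [step]
    split_ifs
    exacts [⟨i, rfl⟩, ⟨j, rfl⟩]

/-- The state after `t` steps of `X` with initial register contents `s`. -/
def run (X : List Instr) (s : Focus → Bool) (t : ℕ) : Thread × (Focus → Bool) :=
  step^[t] (extract X, s)

theorem run_succ (X : List Instr) (s : Focus → Bool) (t : ℕ) :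
    run X s (t + 1) = step (run X s t) :=
  Function.iterate_succ_apply' ..

theorem exists_run_fst_eq (X : List Instr) (s : Focus → Bool) (t : ℕ) :
    ∃ p : Fin (X.length + 1), (run X s t).1 = extractFrom p X := by
  suffices ∃ k, (run X s t).1 = extractFrom k X by
    obtain ⟨k, hk⟩ := this
    rcases le_or_gt X.length k with h | h
    · exact ⟨Fin.last _, by rw [hk, extractFrom_of_length_le h, Fin.val_last,
        extractFrom_of_length_le le_rfl]⟩
    · exact ⟨⟨k, Nat.lt_succ_of_lt h⟩, hk⟩
  induction t with
  | zero => exact ⟨0, rfl⟩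
  | succ t ih =>
    obtain ⟨k, hk⟩ := ih
    rw [run_succ, ← Prod.mk.eta (p := run X s t), hk]
    exact exists_step_extractFrom X k _

/-- The registers that occur in `X`, the first `n` input registers, and `out`. -/
def registers (X : List Instr) (n : ℕ) : Finset Focus :=
  (.out :: (X.map Instr.focus ++ (List.range n).map Focus.inp)).toFinset

theorem out_mem_registers (X : List Instr) (n : ℕ) : .out ∈ registers X n := by
  simp [registers]

theorem inp_mem_registers (X : List Instr) {n i : ℕ} (hi : i < n) : .inp i ∈ registers X n := by
  simp [registers, hi]

theorem focus_extractFrom_mem_registers (X : List Instr) (k n : ℕ) :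
    (extractFrom k X).focus ∈ registers X n := by
  cases h : extractFrom k X with
  | post x a y =>
    exact List.mem_toFinset.2 <| List.mem_cons_of_mem _ <|
      List.mem_append_left _ (exists_of_extractFrom_eq_post h).1
  | _ => exact out_mem_registers X n

/-- The observations of executions of `X` with `n` inputs: at a time `t ≤ X.length`, either that
what remains to be executed is `X` without its first `p` instructions, or the content of a
register. -/
abbrev Observable (X : List Instr) (n : ℕ) : Type :=
  Fin (X.length + 1) × (Fin (X.length + 1) ⊕ registers X n)

theorem card_observable_le (X : List Instr) (n : ℕ) :
    Fintype.card (Observable X n) ≤ (X.length + 1) * (2 * X.length + n + 2) := by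
  have hreg : (registers X n).card ≤ X.length + n + 1 := by
    refine (List.toFinset_card_le _).trans_eq ?_
    simp only [List.length_cons, List.length_append, List.length_map, List.length_range]
  simp only [Fintype.card_prod, Fintype.card_sum, Fintype.card_fin, Fintype.card_coe]
  exact Nat.mul_le_mul_left _ (by omega)

open Classical in
/-- The outcomes of all observations of the execution of `X` with initial register contents `s`. -/
noncomputable def observe (X : List Instr) (n : ℕ) (s : Focus → Bool) : Observable X n → Bool
  | (t, .inl p) => decide ((run X s t).1 = extractFrom p X)
  | (t, .inr f) => (run X s t).2 f

theorem eq_observe_of_mem_tripleClosure {X : List Instr} {n : ℕ} {σ : Observable X n → Bool}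
    (hσ : σ ∈ tripleClosure (Set.range (observe X n))) {s : Focus → Bool}
    (hs : ∀ f : registers X n, σ (0, .inr f) = s f) : σ = observe X n s := by
  suffices ∀ t o, σ (t, o) = observe X n s (t, o) from funext fun u => this u.1 u.2
  intro t
  induction t using Fin.induction with
  | zero =>
    rintro (p | f)
    · refine eq_of_mem_tripleClosure hσ (0, .inl p) (0, .inl p) ?_
      rintro _ ⟨s', rfl⟩ - -
      rfl
    · exact hs f
  | succ t ih =>
    obtain ⟨p, hp⟩ := exists_run_fst_eq X s t
    have hrun : ∀ s', observe X n s' (t.castSucc, .inl p) = σ (t.castSucc, .inl p) →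
        run X s' t = ((run X s t).1, (run X s' t).2) := fun s' hs' => by
      rw [ih] at hs'
      simp only [observe, Fin.val_castSucc, hp, decide_true, decide_eq_true_iff] at hs'
      rw [hp, ← hs']
    have hcontent : ∀ s' f, observe X n s' (t.castSucc, .inr f) = σ (t.castSucc, .inr f) →
        (run X s' t).2 f = (run X s t).2 f := fun s' f hs' => by
      rwa [ih] at hs'
    rintro (q | f)
    · let f : registers X n := ⟨(run X s t).1.focus, hp ▸ focus_extractFrom_mem_registers X p n⟩
      refine eq_of_mem_tripleClosure hσ (t.castSucc, .inl p) (t.castSucc, .inr f) ?_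
      rintro _ ⟨s', rfl⟩ hthread hfocus
      simp only [observe, Fin.val_succ, run_succ, decide_eq_decide]
      rw [hrun s' hthread, step_fst_congr (hcontent s' f hfocus)]
    · refine eq_of_mem_tripleClosure hσ (t.castSucc, .inl p) (t.castSucc, .inr f) ?_
      rintro _ ⟨s', rfl⟩ hthread hf
      simp only [observe, Fin.val_succ, run_succ]
      rw [hrun s' hthread, step_snd_congr _ (hcontent s' f hf)]

/-- The register contents at the start of an execution with input `b`. -/
def initState {n : ℕ} (b : Fin n → Bool) : Focus → Bool
  | .inp i => if h : i < n then b ⟨i, h⟩ else false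
  | _ => false

theorem Computes.run_out {X : List Instr} {n : ℕ} {g : BoolFun n} (hX : Computes X g)
    (b : Fin n → Bool) : (run X (initState b) X.length).2 .out = g b := by
  obtain ⟨l, hl⟩ := computes_iff_exec.1 hX
  refine iterate_step_out_of_exec (fun f c hf => ?_) (hl b) (depth_extractFrom_le X 0)
  cases f with
  | inp i =>
    simp only [initServices, initState] at hf ⊢
    split_ifs at hf ⊢
    simpa using hf
  | aux i =>
    simp only [initServices, initState] at hf ⊢
    split_ifs at hf
    simpa using hf
  | out => simpa [initServices, initState] using hf

/-- The observation of the content of an input register at the start. -/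
def Observable.inp (X : List Instr) {n : ℕ} (i : Fin n) : Observable X n :=
  (0, .inr ⟨.inp i, inp_mem_registers X i.2⟩)

theorem Observable.inp_injective (X : List Instr) (n : ℕ) :
    Function.Injective (Observable.inp X : Fin n → Observable X n) := fun i j h => by
  simpa [Observable.inp, Fin.ext_iff] using h

theorem observe_initState_comp_inp (X : List Instr) {n : ℕ} (b : Fin n → Bool) :
    observe X n (initState b) ∘ Observable.inp X = b := by
  funext i
  simp [observe, Observable.inp, run, initState]

theorem Computes.represents {X : List Instr} {n : ℕ} {g : BoolFun n} (hX : Computes X g) :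
    Represents ((fun b => observe X n (initState b)) '' {b | g b = true}) (Observable.inp X) g := by
  refine ⟨fun b hb => ⟨_, ⟨b, hb, rfl⟩, observe_initState_comp_inp X b⟩, fun σ hσ => ?_⟩
  set b := σ ∘ Observable.inp X with hb
  have hinit : ∀ f : registers X n, σ (0, .inr f) = initState b f := by
    rintro ⟨f, hf⟩
    by_cases hinp : ∃ i : Fin n, f = .inp i
    · obtain ⟨i, rfl⟩ := hinp
      simp [initState, hb, Observable.inp]
    · have hfalse : ∀ b' : Fin n → Bool, initState b' f = false := fun b' => by
        cases f with
        | inp i => simpa [initState] using fun hi => absurd ⟨⟨i, hi⟩, rfl⟩ hinp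
        | _ => rfl
      refine eq_of_mem_tripleClosure hσ (0, .inr ⟨f, hf⟩) (0, .inr ⟨f, hf⟩) ?_
      rintro _ ⟨b', -, rfl⟩ - -
      rw [hfalse]
      exact hfalse b'
  have hσb : σ = observe X n (initState b) := by
    refine eq_observe_of_mem_tripleClosure (tripleClosure_mono ?_ hσ) hinit
    rintro _ ⟨b', -, rfl⟩
    exact ⟨_, rfl⟩
  let o : Observable X n := (Fin.last _, .inr ⟨.out, out_mem_registers X n⟩)
  have ho : ∀ b', observe X n (initState b') o = g b' := hX.run_out
  rw [← ho, ← hσb]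
  refine eq_of_mem_tripleClosure hσ o o ?_
  rintro _ ⟨b', hb', rfl⟩ - -
  exact (ho b').trans hb'

theorem reducible_threeSATC (α : ∀ k, Fin (ndisj k) ≃ Clause k) {IS : Set (List Instr)}
    {f : BoolFamily} (hf : f ∈ NDNUC IS poly) : Reducible ISbr poly f (threeSATC α) := by
  obtain ⟨h, hh, -, g, ⟨p, hp, hg⟩, hfg⟩ := hf
  let N (n : ℕ) : ℕ := n + h n
  have hN : N ∈ poly := add_mem_poly id_mem_poly hh
  have hpN : (fun n => p (N n)) ∈ poly := comp_mem_poly hp hN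
  have hvars : (fun n => (p (N n) + 1) * (2 * p (N n) + N n + 2)) ∈ poly :=
    mul_mem_poly (add_mem_poly hpN (const_mem_poly 1))
      (add_mem_poly (add_mem_poly (mul_mem_poly (const_mem_poly 2) hpN) hN) (const_mem_poly 2))
  refine ⟨_, add_mem_poly (const_mem_poly 5) (comp_mem_poly ndisj_mem_poly hvars), fun n => ?_⟩
  obtain ⟨X, -, hX, hlen⟩ := hg (N n)
  have hcard : Fintype.card (Observable X (N n)) ≤ (p (N n) + 1) * (2 * p (N n) + N n + 2) :=
    (card_observable_le X (N n)).trans (by gcongr)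
  exact ⟨5, _, Nat.le_add_right _ _, (ndisj_mono hcard).trans (Nat.le_add_left _ _),
    (hX.represents.exists_append (hfg n)).lengthReducible_threeSATC
      ((Observable.inp_injective X _).comp (Fin.castAdd_injective _ _)) α⟩

end InSeq

theorem mainTheorem3_general (α : ∀ k : ℕ, Fin (InSeq.ndisj k) ≃ InSeq.Clause k) :
    InSeq.NDComplete InSeq.ISbr InSeq.poly (InSeq.threeSATC α) :=
  ⟨InSeq.threeSATC_mem_NDNUC α, fun _ hg => InSeq.reducible_threeSATC α hg⟩

theorem mainTheorem3
    (α : ∀ k : ℕ, Fin (InSeq.ndisj k) ≃ InSeq.Clause k)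
    (hα : ∀ (k : ℕ) (j : Fin (InSeq.ndisj k)),
      (α (k + 1) (Fin.castLE (InSeq.ndisj_mono (Nat.le_succ k)) j) : Finset InSeq.Literal) =
        (α k j : Finset InSeq.Literal)) :
    InSeq.NDComplete InSeq.ISbr InSeq.poly (InSeq.threeSATC α) :=
  mainTheorem3_general α
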